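/- Let $r\ge 0$ and let $G=\langle s_1,\dots,s_r\rangle$ be either the free group or the free semigroup with identity (free monoid) of rank $r$. Let $\lambda$ be Lebesgue measure on $[0,1]$, let $\lambda^G$ be the product measure on the Borel $\sigma$-algebra of $[0,1]^G$, and let $G$ act on $[0,1]^G$ by the canonical (Bernoulli shift) action $(T_gx)(f)=x(fg)$ for $f,g\in G$. A partition of $[0,1]^G$ is an at most countable collection $\alpha$ of pairwise disjoint measurable sets with union $[0,1]^G$; its entropy is $H(\alpha)=-\sum_{A\in\alpha}\lambda^G(A)\log\lambda^G(A)\in[0,\infty]$, where $0\log 0=0$. Let $\alpha^G$ be the smallest $\sigma$-algebra that contains every element of $\alpha$ and is $G$-invariant, meaning that it contains $T_g^{-1}A$ whenever it contains $A$, for all $g\in G$. The partition $\alpha$ is generating if for every measurable $A\subset[0,1]^G$ there is $A'\in\alpha^G$ with $\lambda^G(A\,\triangle\,A')=0$. Then the action of $G$ on $([0,1]^G,\lambda^G)$ has no generating partition $\alpha$ with $H(\alpha)<\infty$. -/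

import Mathlib

open MeasureTheory
open scoped ENNReal

namespace FreeShift

/-- A partition of `X` into at most countably many measurable subsets. -/
structure IsCountablePartition {X : Type*} [MeasurableSpace X] (α : Set (Set X)) : Prop where
  countable : α.Countable
  measurableSet : ∀ A ∈ α, MeasurableSet A
  pairwiseDisjoint : ∀ A ∈ α, ∀ B ∈ α, A ≠ B → Disjoint A B
  sUnion_eq : ⋃₀ α = Set.univ

/-- The entropy `H(α) = -∑_{A ∈ α} μ(A) log μ(A)`, with `0 log 0 = 0`, as an element of `[0, ∞]`.
For a probability measure every summand is nonnegative, so `ENNReal.ofReal` truncates nothing. -/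
noncomputable def entropy {X : Type*} [MeasurableSpace X] (μ : Measure X) (α : Set (Set X)) :
    ℝ≥0∞ :=
  ∑' A : α, ENNReal.ofReal (-(μ.real (A : Set X) * Real.log (μ.real (A : Set X))))

/-- A σ-algebra `F` is invariant under the maps `T g` if `(T g)⁻¹ A ∈ F` for all `A ∈ F`. -/
def IsInvariantSigmaAlgebra {G X : Type*} (T : G → X → X) (F : MeasurableSpace X) : Prop :=
  ∀ (g : G) (A : Set X), MeasurableSet[F] A → MeasurableSet[F] (T g ⁻¹' A)

/-- `α^G`: the smallest `T`-invariant σ-algebra that contains every element of `α`. -/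
abbrev invariantSigmaAlgebra {G X : Type*} (T : G → X → X) (α : Set (Set X)) : MeasurableSpace X :=
  sInf {F : MeasurableSpace X | IsInvariantSigmaAlgebra T F ∧ ∀ A ∈ α, MeasurableSet[F] A}

/-- `α` is generating: every measurable set agrees, up to measure zero, with a set in `α^G`. -/
def IsGenerating {G X : Type*} [MeasurableSpace X] (T : G → X → X) (μ : Measure X)
    (α : Set (Set X)) : Prop :=
  ∀ A : Set X, MeasurableSet A →
    ∃ A' : Set X, MeasurableSet[invariantSigmaAlgebra T α] A' ∧ μ (symmDiff A A') = 0

/-- The canonical action of a monoid `G` on `K^G`: `(T_g x)(f) = x(fg)`. -/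
def shift (G K : Type*) [Monoid G] (g : G) (x : G → K) : G → K :=
  fun f => x (f * g)

/-- The product measure `λ^G` on `[0,1]^G`, with `λ` Lebesgue measure on `[0,1]`. -/
noncomputable def lebesguePower (G : Type*) : Measure (G → unitInterval) :=
  Measure.infinitePi fun _ : G => (volume : Measure unitInterval)

end FreeShift

/-! A generating partition of entropy `H` would encode the i.i.d. process `[0,1]^G` at about `H`
nats per group element, whereas a single coordinate of `[0,1]` carries more than `log k` nats for
every `k`. To count per element in a possibly nonamenable `G`, the process is modelled on finite
groups: every finite window of `G` embeds in a finite quotient `Q` (`finitelySeparated_freeGroup`).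

Since the partition generates, finitely many labels guess the discretised value at `1` up to a small
error (`exists_guess_of_isGenerating`). The labels are replaced by functions of finitely many
coordinates (`exists_approx_dependsOn`), so that they and the guess make sense on `[0,1]^Q` with
unchanged local statistics. On this finite product a Fano-type inequality, `log_le_of_guess`, bounds
`log k` by the label entropy plus an absolute constant. Letting `k` grow forces `H = ∞`. -/

namespace FreeShift

/-! ### Separation of finite sets by finite groups. -/

/-- Every finite subset of `G` is mapped injectively by a homomorphism to a finite group. -/
def FinitelySeparated (G : Type*) [Monoid G] : Prop :=
  ∀ V : Finset G, ∃ (Q : Type) (_ : Group Q) (_ : Fintype Q) (φ : G →* Q), Set.InjOn φ V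

theorem FinitelySeparated.of_injective {G G' : Type*} [Monoid G] [Monoid G']
    (hG : FinitelySeparated G') (f : G →* G') (hf : Function.Injective f) :
    FinitelySeparated G := by
  classical
  intro V
  obtain ⟨Q, hQ, hQ', φ, hφ⟩ := hG (V.image f)
  refine ⟨Q, hQ, hQ', φ.comp f, fun x hx y hy h => hf (hφ ?_ ?_ h)⟩ <;>
    simp only [Finset.coe_image] <;> exact Set.mem_image_of_mem _ ‹_›

theorem finitelySeparated_freeGroup (r : ℕ) : FinitelySeparated (FreeGroup (Fin r)) := by
  classical
  intro V
  -- All suffixes of the words in `V`: reading a word from right to left, the orbit of `1` stays in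
  -- this set.
  let S : Finset (FreeGroup (Fin r)) :=
    insert 1 (V.biUnion fun w => (w.toWord.tails.map FreeGroup.mk).toFinset)
  have hS : ∀ w ∈ V, ∀ L, L <:+ w.toWord → FreeGroup.mk L ∈ S := by
    intro w hw L hL
    refine Finset.mem_insert_of_mem (Finset.mem_biUnion.2 ⟨w, hw, ?_⟩)
    rw [List.mem_toFinset, List.mem_map]
    exact ⟨L, (List.mem_tails _ _).2 hL, rfl⟩
  -- Left multiplication by a generator is a partial injection of the finite set `S`, so it extends
  -- to a permutation.
  have hσ : ∀ i : Fin r, ∃ σ : Equiv.Perm S, ∀ (x : S) (h : FreeGroup.of i * (x : FreeGroup _) ∈ S),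
      σ x = ⟨FreeGroup.of i * x, h⟩ := by
    intro i
    obtain ⟨σ, hσ⟩ := Equiv.Perm.exists_extending_pair
      (fun x : {x : S // FreeGroup.of i * (x : FreeGroup _) ∈ S} => x.1)
      (fun x => ⟨FreeGroup.of i * x.1, x.2⟩) Subtype.val_injective (by
        intro x y h
        exact Subtype.ext (Subtype.ext (mul_left_cancel (congrArg Subtype.val h))))
    exact ⟨σ, fun x h => hσ ⟨x, h⟩⟩
  choose σ hσ using hσ
  let e : S := ⟨1, Finset.mem_insert_self _ _⟩
  -- The action on `S` carries the base point `1` to the word itself, so distinct words of `V` act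
  -- differently.
  have key : ∀ w ∈ V, ∀ L, L <:+ w.toWord →
      ((FreeGroup.lift σ (FreeGroup.mk L) e : S) : FreeGroup (Fin r)) = FreeGroup.mk L := by
    intro w hw L
    induction L with
    | nil => intro _; simp [e, ← FreeGroup.one_eq_mk]
    | cons a L ih =>
      intro hL
      have hL' : L <:+ w.toWord := (List.suffix_cons a L).trans hL
      have h1 : FreeGroup.lift σ (FreeGroup.mk L) e = ⟨FreeGroup.mk L, hS w hw L hL'⟩ :=
        Subtype.ext (ih hL')
      have h2 : (FreeGroup.mk (a :: L)) = FreeGroup.mk [a] * FreeGroup.mk L := by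
        simp [FreeGroup.mul_mk]
      have h3 := hS w hw _ hL
      rw [h2] at h3
      obtain ⟨i, t⟩ := a
      rw [h2, map_mul, Equiv.Perm.mul_apply, h1]
      cases t
      · have h4 : FreeGroup.mk [(i, false)] = (FreeGroup.of i)⁻¹ := by
          simp [FreeGroup.of, FreeGroup.inv_mk, FreeGroup.invRev]
        rw [h4] at h3 ⊢
        rw [map_inv, FreeGroup.lift_apply_of]
        have h5 : (σ i)⁻¹ ⟨FreeGroup.mk L, hS w hw L hL'⟩ = ⟨_, h3⟩ := by
          rw [Equiv.Perm.inv_eq_iff_eq, hσ i ⟨_, h3⟩ (by simpa using hS w hw L hL')]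
          simp
        rw [h5]
      · have h4 : FreeGroup.mk [(i, true)] = FreeGroup.of i := rfl
        rw [h4] at h3 ⊢
        rw [FreeGroup.lift_apply_of, hσ i _ h3]
  refine ⟨Equiv.Perm S, inferInstance, inferInstance, FreeGroup.lift σ, fun x hx y hy h => ?_⟩
  have hx' := key x hx _ (List.suffix_refl _)
  have hy' := key y hy _ (List.suffix_refl _)
  rw [FreeGroup.mk_toWord] at hx' hy'
  rw [← hx', ← hy', h]

/-- A positive word admits no cancellation, so it is already reduced. This makes the free monoid
embed in the free group. -/
theorem toWord_lift_of {ι : Type*} [DecidableEq ι] (w : FreeMonoid ι) :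
    (FreeMonoid.lift FreeGroup.of w : FreeGroup ι).toWord = w.toList.map fun i => (i, true) := by
  have h : (FreeMonoid.lift FreeGroup.of w : FreeGroup ι) =
      FreeGroup.mk (w.toList.map fun i => (i, true)) := by
    induction w using FreeMonoid.inductionOn' with
    | one => rfl
    | of_mul i w ih =>
      rw [map_mul, ih, FreeMonoid.lift_eval_of, FreeGroup.of, FreeGroup.mul_mk]
      simp
  rw [h, FreeGroup.toWord_mk]
  refine FreeGroup.IsReduced.reduce_eq ?_
  rw [FreeGroup.IsReduced, List.isChain_map]
  simp [List.isChain_iff_forall_rel_of_append_cons_cons]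

theorem finitelySeparated_freeMonoid (r : ℕ) : FinitelySeparated (FreeMonoid (Fin r)) := by
  refine (finitelySeparated_freeGroup r).of_injective (FreeMonoid.lift FreeGroup.of) ?_
  intro x y h
  have h' := congrArg FreeGroup.toWord h
  rw [toWord_lift_of, toWord_lift_of] at h'
  exact FreeMonoid.toList.injective
    (List.map_injective_iff.2 (fun i j hij => (Prod.ext_iff.1 hij).1) h')

/-! ### A Fano-type inequality on a finite product. -/

/-- A conditional distribution on `Fin (k + 1)` favouring the value `c`. -/
noncomputable def guessWeight (k : ℕ) (c b : Fin (k + 1)) : ℝ :=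
  (if b = c then 1 / 2 else 0) + 1 / (2 * (k + 1))

theorem guessWeight_pos {k : ℕ} (c b : Fin (k + 1)) : 0 < guessWeight k c b := by
  unfold guessWeight
  have : (0 : ℝ) < 1 / (2 * (k + 1)) := by positivity
  split_ifs <;> linarith

/-- The price of coding a value given its guess: `log 2` when the guess is right, a further `log (k
+ 1)` only when it is wrong. -/
theorem neg_log_guessWeight_le {k : ℕ} (c b : Fin (k + 1)) :
    -Real.log (guessWeight k c b) ≤ Real.log 2 + if b = c then 0 else Real.log (k + 1) := by
  have hk : (0 : ℝ) < 1 / (2 * (k + 1)) := by positivity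
  split_ifs with h
  · have : Real.log (1 / 2) ≤ Real.log (guessWeight k c b) :=
      Real.log_le_log (by norm_num) (by rw [guessWeight, if_pos h]; linarith)
    rw [one_div, Real.log_inv] at this
    linarith
  · rw [guessWeight, if_neg h, zero_add, one_div, Real.log_inv, neg_neg,
      Real.log_mul (by norm_num) (by positivity)]

theorem integrable_comp_of_finite {X T : Type*} [MeasurableSpace X] {μ : Measure X}
    [IsFiniteMeasure μ] [Finite T] [MeasurableSpace T] [MeasurableSingletonClass T] (F : T → ℝ)
    {q : X → T} (hq : Measurable q) : Integrable (fun x => F (q x)) μ :=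
  (Integrable.of_finite (μ := μ.map q) (f := F)).comp_measurable hq

section
variable {K : Type*} [MeasurableSpace K] (κ : Measure K) [IsProbabilityMeasure κ]

/-- The peak at `c` has mass at most `1 / k` and contributes at most `1 / 2`; the uniform part
contributes `k / (2 * (k + 1))`, again at most `1 / 2`. -/
theorem integral_guessWeight_le {k : ℕ} {b : K → Fin (k + 1)} (hb : Measurable b)
    (hbk : ∀ i, κ.real (b ⁻¹' {i}) ≤ 1 / k) (c : Fin (k + 1)) :
    ∫ t, k * guessWeight k c (b t) ∂κ ≤ 1 := by
  have hms : MeasurableSet (b ⁻¹' {c}) := hb (measurableSet_singleton c)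
  have h1 : ∀ t, (k : ℝ) * guessWeight k c (b t) =
      (b ⁻¹' {c}).indicator (fun _ => (k : ℝ) / 2) t + k / (2 * (k + 1)) := by
    intro t
    by_cases h : b t = c
    · rw [Set.indicator_of_mem (by exact h), guessWeight, if_pos h]; ring
    · rw [Set.indicator_of_notMem (by exact h), guessWeight, if_neg h]; ring
  simp_rw [h1]
  rw [integral_add ((integrable_const _).indicator hms) (integrable_const _),
    integral_indicator_const _ hms]
  simp only [integral_const, probReal_univ, smul_eq_mul, one_mul]
  have h2 : κ.real (b ⁻¹' {c}) * (k / 2 : ℝ) ≤ 1 / 2 := by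
    rcases Nat.eq_zero_or_pos k with rfl | hk
    · simp
    · have hk' : (0 : ℝ) < k := by exact_mod_cast hk
      calc _ ≤ 1 / (k : ℝ) * (k / 2) := by gcongr; exact hbk c
        _ = 1 / 2 := by field_simp
  have h3 : (k : ℝ) / (2 * (k + 1)) ≤ 1 / 2 := by
    rw [div_le_div_iff₀ (by positivity) (by norm_num)]; linarith
  linarith

variable {V L : Type*} [Fintype V] [Fintype L]

/-- A sub-probability model for the labels together with a guess for the base values integrates to
at most `1`. -/
theorem integral_prod_weights_le {k : ℕ} {b : K → Fin (k + 1)} (hb : Measurable b)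
    (hbk : ∀ i, κ.real (b ⁻¹' {i}) ≤ 1 / k) (a : V → (V → K) → L)
    {p : L → ℝ} (hp : ∀ l, 0 < p l) (hp1 : ∑ l, p l ≤ 1) (c : V → (V → L) → Fin (k + 1)) :
    ∫ y, ∏ v, (p (a v y) * (k * guessWeight k (c v fun w => a w y) (b (y v))))
      ∂(Measure.pi fun _ : V => κ) ≤ 1 := by
  classical
  let h : Fin (k + 1) → K → ℝ := fun i t => k * guessWeight k i (b t)
  have hh0 : ∀ i t, 0 ≤ h i t := fun i t => mul_nonneg k.cast_nonneg (guessWeight_pos _ _).le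
  have hhm : ∀ i, Measurable (h i) := fun i =>
    ((measurable_of_finite (guessWeight k i)).comp hb).const_mul _
  have hhb : ∀ i t, h i t ≤ k * 1 := by
    intro i t
    refine mul_le_mul_of_nonneg_left ?_ k.cast_nonneg
    have : 1 / (2 * ((k : ℝ) + 1)) ≤ 1 / 2 := by
      apply one_div_le_one_div_of_le <;> linarith [k.cast_nonneg (α := ℝ)]
    unfold guessWeight
    split_ifs <;> linarith
  have hint : ∀ u : V → L, Integrable (fun y : V → K => ∏ v, h (c v u) (y v))
      (Measure.pi fun _ : V => κ) := by
    intro u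
    refine Integrable.of_bound (C := ∏ _v : V, (k * 1 : ℝ))
      (Finset.measurable_prod _ fun v _ =>
        (hhm _).comp (measurable_pi_apply v)).aestronglyMeasurable (ae_of_all _ fun y => ?_)
    rw [Real.norm_of_nonneg (Finset.prod_nonneg fun v _ => hh0 _ _)]
    exact Finset.prod_le_prod (fun v _ => hh0 _ _) fun v _ => hhb _ _
  -- Summing over all label patterns `u`, not only the one produced by `y`, freezes the guesses. For
  -- fixed `u` the integrand is a product over independent coordinates.
  calc _ ≤ ∫ y, ∑ u : V → L, (∏ v, p (u v)) * ∏ v, h (c v u) (y v)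
        ∂(Measure.pi fun _ : V => κ) := by
        refine integral_mono_of_nonneg (ae_of_all _ fun y => ?_)
          (integrable_finsetSum _ fun u _ => (hint u).const_mul _) (ae_of_all _ fun y => ?_)
        · exact Finset.prod_nonneg fun v _ => mul_nonneg (hp _).le (hh0 _ _)
        · simp only
          rw [Finset.prod_mul_distrib]
          exact Finset.single_le_sum
            (f := fun u : V → L => (∏ v, p (u v)) * ∏ v, h (c v u) (y v))
            (fun u _ => mul_nonneg (Finset.prod_nonneg fun v _ => (hp _).le)
              (Finset.prod_nonneg fun v _ => hh0 _ _)) (Finset.mem_univ fun w => a w y)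
    _ = ∑ u : V → L, (∏ v, p (u v)) * ∏ v, ∫ t, h (c v u) t ∂κ := by
        rw [integral_finsetSum _ fun u _ => (hint u).const_mul _]
        refine Finset.sum_congr rfl fun u _ => ?_
        rw [integral_const_mul, integral_fintype_prod_eq_prod (fun v t => h (c v u) t)]
    _ ≤ ∑ u : V → L, ∏ v, p (u v) := by
        refine Finset.sum_le_sum fun u _ => ?_
        refine mul_le_of_le_one_right (Finset.prod_nonneg fun v _ => (hp _).le) ?_
        exact Finset.prod_le_one (fun v _ => integral_nonneg (hh0 _))
          fun v _ => integral_guessWeight_le κ hb hbk _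
    _ = (∑ l, p l) ^ Fintype.card V := by
        have := Finset.prod_univ_sum (fun _ : V => (Finset.univ : Finset L)) fun _ l => p l
        rw [Finset.prod_const, Finset.card_univ, Fintype.piFinset_univ] at this
        exact this.symm
    _ ≤ 1 := pow_le_one₀ (Finset.sum_nonneg fun l _ => (hp l).le) hp1

/-- If labels `a v` with small cross-entropy allow to guess the i.i.d. base values `b (y v)` with
small error, then the base values have few atoms. -/
theorem log_le_of_guess [Nonempty V] {k : ℕ} (hk : 0 < k) {b : K → Fin (k + 1)} (hb : Measurable b)
    (hbk : ∀ i, κ.real (b ⁻¹' {i}) ≤ 1 / k) [MeasurableSpace L] [MeasurableSingletonClass L]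
    {a : V → (V → K) → L} (ha : ∀ v, Measurable (a v))
    {p : L → ℝ} (hp : ∀ l, 0 < p l) (hp1 : ∑ l, p l ≤ 1) (c : V → (V → L) → Fin (k + 1))
    {C D : ℝ} (hC : ∀ v, ∫ y, -Real.log (p (a v y)) ∂(Measure.pi fun _ : V => κ) ≤ C)
    (hD : ∀ v, Real.log (k + 1) * (Measure.pi fun _ : V => κ).real
      {y | b (y v) ≠ c v fun w => a w y} ≤ D) :
    Real.log k ≤ C + Real.log 2 + D := by
  classical
  have hk' : (0 : ℝ) < k := by exact_mod_cast hk
  let ν : Measure (V → K) := Measure.pi fun _ : V => κ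
  let g : V → (V → K) → ℝ := fun v y => guessWeight k (c v fun w => a w y) (b (y v))
  have ham : Measurable fun y w => a w y := measurable_pi_lambda _ ha
  have hcm : ∀ v, Measurable fun y => c v fun w => a w y := fun v =>
    (measurable_of_finite (c v)).comp ham
  have hbm : ∀ v, Measurable fun y : V → K => b (y v) := fun v => hb.comp (measurable_pi_apply v)
  have hg0 : ∀ v y, 0 < g v y := fun v y => guessWeight_pos _ _
  -- `Z` acts as a likelihood ratio with integral at most `1`. As in Gibbs' inequality, `log Z ≤ Z -
  -- 1` gives `∫ log Z ≤ 0`, and `log Z` is a sum over sites each of whose means is bounded below.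
  let Z : (V → K) → ℝ := fun y => ∏ v, (p (a v y) * (k * g v y))
  have hZ0 : ∀ y, 0 < Z y := fun y =>
    Finset.prod_pos fun v _ => mul_pos (hp _) (mul_pos hk' (hg0 v y))
  have hpi : ∀ v, Integrable (fun y => Real.log (p (a v y))) ν := fun v =>
    integrable_comp_of_finite (fun l => Real.log (p l)) (ha v)
  have hgi : ∀ v, Integrable (fun y => Real.log (g v y)) ν := fun v =>
    integrable_comp_of_finite (fun q : Fin (k + 1) × Fin (k + 1) => Real.log (guessWeight k q.1 q.2))
      ((hcm v).prodMk (hbm v))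
  have hZi : Integrable Z ν := by
    have := integrable_comp_of_finite (μ := ν)
      (fun q : (V → L) × (V → Fin (k + 1)) => ∏ v, (p (q.1 v) * (k * guessWeight k (c v q.1) (q.2 v))))
      (ham.prodMk (measurable_pi_lambda _ hbm))
    exact this
  have hlogZ : ∀ y, Real.log (Z y) =
      ∑ v, (Real.log (p (a v y)) + (Real.log k + Real.log (g v y))) := by
    intro y
    rw [Real.log_prod fun v _ => (mul_pos (hp _) (mul_pos hk' (hg0 v y))).ne']
    refine Finset.sum_congr rfl fun v _ => ?_
    rw [Real.log_mul (hp _).ne' (mul_pos hk' (hg0 v y)).ne', Real.log_mul hk'.ne' (hg0 v y).ne']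
  have hsi : ∀ v, Integrable
      (fun y => Real.log (p (a v y)) + (Real.log k + Real.log (g v y))) ν := fun v =>
    (hpi v).add ((integrable_const _).add (hgi v))
  have hle : ∫ y, ∑ v, (Real.log (p (a v y)) + (Real.log k + Real.log (g v y))) ∂ν ≤ 0 := by
    calc _ ≤ ∫ y, (Z y - 1) ∂ν := by
          refine integral_mono (integrable_finsetSum _ fun v _ => hsi v)
            (hZi.sub (integrable_const _)) fun y => ?_
          simp only
          rw [← hlogZ]
          exact Real.log_le_sub_one_of_pos (hZ0 y)
      _ ≤ 0 := by
          rw [integral_sub hZi (integrable_const _)]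
          have : ∫ y, Z y ∂ν ≤ 1 := integral_prod_weights_le κ hb hbk a hp hp1 c
          simpa using this
  have hv : ∀ v, Real.log k - C - Real.log 2 - D ≤
      ∫ y, (Real.log (p (a v y)) + (Real.log k + Real.log (g v y))) ∂ν := by
    intro v
    have hms : MeasurableSet {y | b (y v) ≠ c v fun w => a w y} :=
      (measurableSet_eq_fun (hbm v) (hcm v)).compl
    have h1 : -∫ y, Real.log (g v y) ∂ν ≤ Real.log 2 + D := by
      rw [← integral_neg]
      calc _ ≤ ∫ y, (Real.log 2 + {y | b (y v) ≠ c v fun w => a w y}.indicator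
              (fun _ => Real.log (k + 1)) y) ∂ν := by
            refine integral_mono (hgi v).neg
              ((integrable_const _).add ((integrable_const _).indicator hms)) fun y => ?_
            refine (neg_log_guessWeight_le _ _).trans (add_le_add le_rfl (le_of_eq ?_))
            by_cases h : b (y v) = c v fun w => a w y
            · rw [if_pos h, Set.indicator_of_notMem (by simpa using h)]
            · rw [if_neg h, Set.indicator_of_mem (by exact h)]
        _ ≤ _ := by
            rw [integral_add (integrable_const _) ((integrable_const _).indicator hms),
              integral_indicator_const _ hms]
            have := hD v
            simp only [integral_const, probReal_univ, smul_eq_mul, one_mul]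
            rw [mul_comm] at this
            exact add_le_add le_rfl this
    have h2 := hC v
    rw [integral_neg] at h2
    rw [integral_add (hpi v) (g := fun y => Real.log k + Real.log (g v y))
        ((integrable_const _).add (hgi v)),
      integral_add (integrable_const _) (hgi v)]
    simp only [integral_const, probReal_univ, smul_eq_mul, one_mul]
    change -∫ y, Real.log (p (a v y)) ∂ν ≤ C at h2
    linarith
  rw [integral_finsetSum _ fun v _ => hsi v] at hle
  have h3 := (Finset.sum_le_sum fun v _ => hv v).trans hle
  rw [Finset.sum_const, nsmul_eq_mul] at h3
  have h4 : (0 : ℝ) < (Finset.univ : Finset V).card := by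
    exact_mod_cast Finset.card_pos.2 Finset.univ_nonempty
  have := nonpos_of_mul_nonpos_right h3 h4
  linarith

end

/-! ### Reindexing of product measures. -/

section
variable {K : Type*} [MeasurableSpace K] (κ : Measure K) [IsProbabilityMeasure κ]

theorem map_comp_infinitePi {ι V : Type*} {j : ι → V} (hj : Function.Injective j) :
    (Measure.infinitePi fun _ : V => κ).map (fun y i => y (j i)) =
      Measure.infinitePi fun _ : ι => κ := by
  classical
  refine Measure.eq_infinitePi _ fun s t ht => ?_
  have hm : Measurable fun (y : V → K) i => y (j i) := by fun_prop
  rw [Measure.map_apply hm (MeasurableSet.pi s.countable_toSet fun i _ => ht i)]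
  rcases isEmpty_or_nonempty ι with hι | hι
  · have : s = ∅ := Subsingleton.elim _ _
    subst this
    simp
  have h : (fun (y : V → K) i => y (j i)) ⁻¹' Set.pi s t =
      Set.pi ↑(s.map ⟨j, hj⟩) fun v => t (Function.invFun j v) := by
    ext y
    simp [Set.mem_pi, Function.leftInverse_invFun hj _]
  rw [h, Measure.infinitePi_pi _ fun v _ => ht _, Finset.prod_map]
  simp [Function.leftInverse_invFun hj _]

/-- The probability of an event that depends on the coordinates in `W` is not changed by a
reindexing which is injective on `W`. -/
theorem infinitePi_preimage_of_injOn {ι V : Type*} {j : ι → V} {W : Set ι} (hj : W.InjOn j)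
    {A : Set (ι → K)} (hA : MeasurableSet A) (hW : DependsOn (· ∈ A) W) :
    (Measure.infinitePi fun _ : V => κ) {y | (fun i => y (j i)) ∈ A} =
      (Measure.infinitePi fun _ : ι => κ) A := by
  classical
  obtain ⟨z⟩ : Nonempty K := κ.nonempty_of_neZero
  -- The filler `z` outside `W` is harmless because membership in `A` ignores those coordinates.
  let e : (W → K) → ι → K := fun u i => if h : i ∈ W then u ⟨i, h⟩ else z
  have he : Measurable e := by
    refine measurable_pi_lambda _ fun i => ?_
    by_cases h : i ∈ W
    · simpa [e, h] using measurable_pi_apply _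
    · simp [e, h]
  have hAe : ∀ x : ι → K, x ∈ A ↔ e (fun i => x i) ∈ A := fun x =>
    iff_of_eq (hW fun i hi => by simp [e, hi])
  have h1 : {y : V → K | (fun i => y (j i)) ∈ A} =
      (fun (y : V → K) (i : W) => y (j i)) ⁻¹' (e ⁻¹' A) := by
    ext y; exact hAe _
  have h2 : A = (fun (x : ι → K) (i : W) => x i) ⁻¹' (e ⁻¹' A) := by
    ext y; exact hAe _
  conv_rhs => rw [h2]
  rw [h1, ← Measure.map_apply (by fun_prop) (he hA), ← Measure.map_apply (by fun_prop) (he hA),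
    map_comp_infinitePi κ Subtype.val_injective,
    map_comp_infinitePi κ (j := fun i : W => j i) hj.injective]

end

/-! ### Approximation of finite-valued functions. -/

/-- A finite-valued function whose fibers are almost everywhere equal to sets in the σ-algebra
generated by an algebra of sets is approximated by functions with fibers in the algebra. -/
theorem exists_approx_of_isSetAlgebra {X L : Type*} [MeasurableSpace X] (μ : Measure X)
    [IsFiniteMeasure μ] {𝒜 : Set (Set X)} (h𝒜 : IsSetAlgebra 𝒜)
    (hm : ∀ A ∈ 𝒜, MeasurableSet A) [Fintype L] [Nonempty L] (ℓ : X → L)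
    (hℓ : ∀ l, ∃ D, MeasurableSet[MeasurableSpace.generateFrom 𝒜] D ∧
      μ (symmDiff (ℓ ⁻¹' {l}) D) = 0) {ε : ℝ} (hε : 0 < ε) :
    ∃ ℓ' : X → L, (∀ l, ℓ' ⁻¹' {l} ∈ 𝒜) ∧ μ.real {x | ℓ x ≠ ℓ' x} < ε := by
  classical
  have hle : MeasurableSpace.generateFrom 𝒜 ≤ ‹MeasurableSpace X› :=
    MeasurableSpace.generateFrom_le hm
  have hN : (0 : ℝ) < Fintype.card L := by exact_mod_cast Fintype.card_pos
  have h1 : ∀ l, ∃ B ∈ 𝒜, μ.real (symmDiff (ℓ ⁻¹' {l}) B) < ε / Fintype.card L := by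
    intro l
    obtain ⟨D, hD, hD0⟩ := hℓ l
    -- The algebra generates only a sub-σ-algebra, so density is applied to the trimmed measure.
    have hdense := @Measure.MeasureDense.of_generateFrom_isSetAlgebra_finite X
      (MeasurableSpace.generateFrom 𝒜) (μ.trim hle) 𝒜 _ h𝒜 rfl
    obtain ⟨B, hB, hDB⟩ := @Measure.MeasureDense.approx X
      (MeasurableSpace.generateFrom 𝒜) (μ.trim hle) 𝒜 hdense D hD (measure_ne_top _ _) (ε / Fintype.card L)
      (by positivity)
    refine ⟨B, hB, ?_⟩
    have hBm : MeasurableSet[MeasurableSpace.generateFrom 𝒜] B :=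
      MeasurableSpace.measurableSet_generateFrom hB
    rw [trim_measurableSet_eq hle (hD.symmDiff hBm)] at hDB
    rw [Measure.real, ← ENNReal.lt_ofReal_iff_toReal_lt (measure_ne_top _ _)]
    calc _ ≤ μ (symmDiff (ℓ ⁻¹' {l}) D) + μ (symmDiff D B) := measure_symmDiff_le _ _ _
      _ < _ := by rwa [hD0, zero_add]
  choose B hB hBε using h1
  let l₀ : L := Classical.arbitrary L
  -- The sets `B l` need not be a partition; points lying in none or several of them get the default
  -- `l₀`. Hence the fiber over `l₀` is handled below as a complement.
  let ℓ' : X → L := fun x => if h : ∃! l, x ∈ B l then h.choose else l₀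
  have hℓ'1 : ∀ x l, x ∈ B l → (∀ l', x ∈ B l' → l' = l) → ℓ' x = l := by
    intro x l h h'
    have hu : ∃! l, x ∈ B l := ⟨l, h, h'⟩
    simp only [ℓ', dif_pos hu]
    exact h' _ hu.choose_spec.1
  have hfib : ∀ l, l ≠ l₀ → ℓ' ⁻¹' {l} ∈ 𝒜 := by
    intro l hl
    have : ℓ' ⁻¹' {l} = B l \ ⋃ l' ∈ Finset.univ.erase l, B l' := by
      ext x
      simp only [Set.mem_preimage, Set.mem_singleton_iff, Set.mem_sdiff, Set.mem_iUnion,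
        Finset.mem_erase, Finset.mem_univ, and_true, not_exists]
      constructor
      · intro h
        by_cases hu : ∃! l, x ∈ B l
        · simp only [ℓ', dif_pos hu] at h
          subst h
          exact ⟨hu.choose_spec.1, fun l' hl' hx => hl' (hu.choose_spec.2 _ hx)⟩
        · simp only [ℓ', dif_neg hu] at h
          exact absurd h.symm hl
      · rintro ⟨h, h'⟩
        exact hℓ'1 x l h fun l' hx => by
          by_contra hne
          exact h' l' hne hx
    rw [this]
    exact h𝒜.sdiff_mem (hB l) (h𝒜.biUnion_mem _ fun l' _ => hB l')
  refine ⟨ℓ', fun l => ?_, ?_⟩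
  · by_cases hl : l = l₀
    · have : ℓ' ⁻¹' {l} = (⋃ l' ∈ Finset.univ.erase l₀, ℓ' ⁻¹' {l'})ᶜ := by
        ext x
        simp only [hl, Set.mem_preimage, Set.mem_singleton_iff, Finset.mem_erase, Finset.mem_univ,
          and_true, Set.compl_iUnion, Set.mem_iInter, Set.mem_compl_iff]
        exact ⟨fun h i hi h' => hi (h'.symm.trans h), fun h => by_contra fun h' => h _ h' rfl⟩
      rw [this]
      exact h𝒜.compl_mem (h𝒜.biUnion_mem _ fun l' hl' => hfib l' (Finset.ne_of_mem_erase hl'))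
    · exact hfib l hl
  · have hsub : {x | ℓ x ≠ ℓ' x} ⊆ ⋃ l, symmDiff (ℓ ⁻¹' {l}) (B l) := by
      intro x hx
      by_contra hn
      have hxl : ∀ l, ℓ x = l ↔ x ∈ B l := by
        intro l
        have := fun h => hn (Set.mem_iUnion.2 ⟨l, h⟩)
        rw [Set.mem_symmDiff] at this
        simp only [Set.mem_preimage, Set.mem_singleton_iff] at this
        tauto
      exact hx (hℓ'1 x (ℓ x) ((hxl _).1 rfl) fun l' h => ((hxl l').2 h).symm).symm
    calc _ ≤ μ.real (⋃ l, symmDiff (ℓ ⁻¹' {l}) (B l)) := measureReal_mono hsub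
      _ ≤ ∑ l, μ.real (symmDiff (ℓ ⁻¹' {l}) (B l)) := measureReal_iUnion_fintype_le _
      _ < ∑ _l : L, ε / Fintype.card L :=
        Finset.sum_lt_sum_of_nonempty Finset.univ_nonempty fun l _ => hBε l
      _ = ε := by
        rw [Finset.sum_const, Finset.card_univ, nsmul_eq_mul]; field_simp

theorem isSetAlgebra_measurableCylinders {ι : Type*} {K : Type*} [MeasurableSpace K] :
    IsSetAlgebra (measurableCylinders fun _ : ι => K) where
  empty_mem := empty_mem_measurableCylinders _
  compl_mem := fun _ => compl_mem_measurableCylinders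
  union_mem := fun _ _ => union_mem_measurableCylinders

/-- A finite-valued measurable function on a product space is approximated by functions of finitely
many coordinates. -/
theorem exists_approx_dependsOn {ι K L : Type*} [MeasurableSpace K] (μ : Measure (ι → K))
    [IsFiniteMeasure μ] [Fintype L] [Nonempty L] [MeasurableSpace L] [MeasurableSingletonClass L]
    {ℓ : (ι → K) → L} (hℓ : Measurable ℓ) {ε : ℝ} (hε : 0 < ε) :
    ∃ (ℓ' : (ι → K) → L) (W : Finset ι), Measurable ℓ' ∧ DependsOn ℓ' W ∧
      μ.real {x | ℓ x ≠ ℓ' x} < ε := by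
  classical
  obtain ⟨ℓ', hfib, hlt⟩ := exists_approx_of_isSetAlgebra μ
    (isSetAlgebra_measurableCylinders (ι := ι) (K := K))
    (fun _ h => MeasurableSet.of_mem_measurableCylinders h) ℓ
    (fun l => ⟨ℓ ⁻¹' {l}, by
      rw [generateFrom_measurableCylinders]; exact hℓ (measurableSet_singleton l), by simp⟩) hε
  have hcyl := fun l => (mem_measurableCylinders _).1 (hfib l)
  choose W S _ hWS using hcyl
  refine ⟨ℓ', Finset.univ.biUnion W, measurable_to_countable' fun l =>
    MeasurableSet.of_mem_measurableCylinders (hfib l), fun x y hxy => ?_, hlt⟩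
  have hx : x ∈ ℓ' ⁻¹' {ℓ' x} := rfl
  have hy : y ∈ ℓ' ⁻¹' {ℓ' x} := by
    rw [hWS, mem_cylinder] at hx ⊢
    convert hx using 1
    ext i
    exact (hxy i (Finset.mem_coe.2 (Finset.mem_biUnion.2 ⟨_, Finset.mem_univ _, i.2⟩))).symm
  exact hy.symm

/-! ### Cross-entropy of finite labels. -/

section
variable {X L : Type*} [MeasurableSpace X] {μ : Measure X} [IsProbabilityMeasure μ]
  [Fintype L] [MeasurableSpace L] [MeasurableSingletonClass L]

theorem integral_comp_of_finite {ℓ : X → L} (hℓ : Measurable ℓ) (f : L → ℝ) :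
    ∫ x, f (ℓ x) ∂μ = ∑ l, μ.real (ℓ ⁻¹' {l}) * f l := by
  have hp : IsProbabilityMeasure (μ.map ℓ) := Measure.isProbabilityMeasure_map hℓ.aemeasurable
  rw [← integral_map hℓ.aemeasurable (measurable_of_finite f).aestronglyMeasurable,
    integral_fintype (Integrable.of_finite)]
  refine Finset.sum_congr rfl fun l _ => ?_
  rw [map_measureReal_apply hℓ (measurableSet_singleton l), smul_eq_mul]

theorem sum_measureReal_fiber {ℓ : X → L} (hℓ : Measurable ℓ) :
    ∑ l, μ.real (ℓ ⁻¹' {l}) = 1 := by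
  have := integral_comp_of_finite (μ := μ) hℓ fun _ => 1
  simpa using this.symm

/-- A positive probability vector whose cross-entropy with the law of `ℓ` is almost optimal. -/
theorem exists_weight [Nonempty L] {ℓ : X → L} (hℓ : Measurable ℓ) :
    ∃ p : L → ℝ, (∀ l, 0 < p l) ∧ ∑ l, p l ≤ 1 ∧
      ∫ x, -Real.log (p (ℓ x)) ∂μ ≤
        Real.log 2 + ∑ l, Real.negMulLog (μ.real (ℓ ⁻¹' {l})) := by
  have hN : (0 : ℝ) < Fintype.card L := by exact_mod_cast Fintype.card_pos
  have hN' : (0 : ℝ) < 1 / (2 * Fintype.card L) := by positivity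
  -- Averaging the law of `ℓ` with the uniform law makes every weight positive, at a cost of at most
  -- `log 2`.
  let p : L → ℝ := fun l => μ.real (ℓ ⁻¹' {l}) / 2 + 1 / (2 * Fintype.card L)
  refine ⟨p, fun l => ?_, ?_, ?_⟩
  · have : 0 ≤ μ.real (ℓ ⁻¹' {l}) := measureReal_nonneg
    simp only [p]
    linarith
  · simp only [p]
    rw [Finset.sum_add_distrib, ← Finset.sum_div, sum_measureReal_fiber hℓ, Finset.sum_const,
      Finset.card_univ, nsmul_eq_mul]
    field_simp
    norm_num
  · rw [integral_comp_of_finite hℓ fun l => -Real.log (p l)]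
    calc _ ≤ ∑ l, (μ.real (ℓ ⁻¹' {l}) * Real.log 2 + Real.negMulLog (μ.real (ℓ ⁻¹' {l}))) := by
          refine Finset.sum_le_sum fun l _ => ?_
          rcases (measureReal_nonneg : 0 ≤ μ.real (ℓ ⁻¹' {l})).eq_or_lt with h | h
          · simp [← h]
          · have h1 : Real.log (μ.real (ℓ ⁻¹' {l}) / 2) ≤ Real.log (p l) :=
              Real.log_le_log (by positivity) (by simp only [p]; linarith)
            rw [Real.log_div h.ne' (by norm_num)] at h1
            rw [Real.negMulLog, neg_mul, ← mul_neg, ← mul_add]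
            exact mul_le_mul_of_nonneg_left (by linarith) h.le
      _ = _ := by
          rw [Finset.sum_add_distrib, ← Finset.sum_mul, sum_measureReal_fiber hℓ, one_mul]

/-- Where the two labels differ, `f (ℓ' x)` is at most the sum of all values of `f`. -/
theorem integral_comp_le_of_approx {ℓ ℓ' : X → L} (hℓ : Measurable ℓ) (hℓ' : Measurable ℓ')
    {f : L → ℝ} (hf : ∀ l, 0 ≤ f l) :
    ∫ x, f (ℓ' x) ∂μ ≤ ∫ x, f (ℓ x) ∂μ + μ.real {x | ℓ x ≠ ℓ' x} * ∑ l, f l := by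
  classical
  have hms : MeasurableSet {x | ℓ x ≠ ℓ' x} := (measurableSet_eq_fun hℓ hℓ').compl
  have hi : Integrable ({x | ℓ x ≠ ℓ' x}.indicator fun _ => ∑ l, f l) μ :=
    (integrable_const _).indicator hms
  rw [← smul_eq_mul, ← integral_indicator_const _ hms,
    ← integral_add (integrable_comp_of_finite f hℓ) hi]
  refine integral_mono (integrable_comp_of_finite f hℓ')
    ((integrable_comp_of_finite f hℓ).add hi) fun x => ?_
  by_cases h : ℓ x = ℓ' x
  · simp [h]
  · simp only [Set.indicator_of_mem (show x ∈ {x | ℓ x ≠ ℓ' x} from h)]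
    have := Finset.single_le_sum (fun l _ => hf l) (Finset.mem_univ (ℓ' x))
    linarith [hf (ℓ x)]

end

/-! ### Finite labels from a partition and its invariant σ-algebra. -/

section
variable {G X : Type*}

/-- The sets determined by the memberships `T g x ∈ A` for finitely many `g` and `A ∈ α`. -/
def finitelyDetermined (T : G → X → X) (α : Set (Set X)) : Set (Set X) :=
  {D | ∃ (s : Finset α) (F : Finset G), ∀ x y,
    (∀ g ∈ F, ∀ A ∈ s, (T g x ∈ (A : Set X) ↔ T g y ∈ (A : Set X))) → (x ∈ D ↔ y ∈ D)}

theorem isSetAlgebra_finitelyDetermined (T : G → X → X) (α : Set (Set X)) :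
    IsSetAlgebra (finitelyDetermined T α) where
  empty_mem := ⟨∅, ∅, fun _ _ _ => Iff.rfl⟩
  compl_mem := by
    rintro D ⟨s, F, h⟩
    exact ⟨s, F, fun x y hxy => not_congr (h x y hxy)⟩
  union_mem := by
    classical
    rintro D D' ⟨s, F, h⟩ ⟨s', F', h'⟩
    exact ⟨s ∪ s', F ∪ F', fun x y hxy => or_congr
      (h x y fun g hg A hA => hxy g (Finset.mem_union_left _ hg) A (Finset.mem_union_left _ hA))
      (h' x y fun g hg A hA =>
        hxy g (Finset.mem_union_right _ hg) A (Finset.mem_union_right _ hA))⟩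

/-- Such a set is the preimage of its image under a measurable map into a finite table of
memberships. -/
theorem measurableSet_of_mem_finitelyDetermined [MeasurableSpace X] {T : G → X → X}
    (hT : ∀ g, Measurable (T g)) {α : Set (Set X)} (hα : ∀ A ∈ α, MeasurableSet A) {D : Set X}
    (hD : D ∈ finitelyDetermined T α) : MeasurableSet D := by
  obtain ⟨s, F, h⟩ := hD
  let f : X → F → s → Prop := fun x g A => T g x ∈ ((A : α) : Set X)
  have hf : Measurable f := measurable_pi_lambda _ fun g => measurable_pi_lambda _ fun A =>
    measurableSet_setOfPred.1 (hT g (hα _ (A : α).2))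
  have hfD : D = f ⁻¹' (f '' D) := by
    refine Set.Subset.antisymm (Set.subset_preimage_image f D) ?_
    rintro x ⟨y, hy, hyx⟩
    exact (h y x fun g hg A hA => iff_of_eq (congrFun (congrFun hyx ⟨g, hg⟩) ⟨A, hA⟩)).1 hy
  rw [hfD]
  exact hf (Set.toFinite _).measurableSet

/-- The larger σ-algebra is itself invariant: pulling back by `T h` turns the window `F` into `F *
h`. -/
theorem invariantSigmaAlgebra_le [Monoid G] {T : G → X → X} (hT : ∀ g h x, T g (T h x) = T (g * h) x)
    (hT1 : ∀ x, T 1 x = x) (α : Set (Set X)) :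
    invariantSigmaAlgebra T α ≤ MeasurableSpace.generateFrom (finitelyDetermined T α) := by
  classical
  refine sInf_le ⟨fun h A hA => ?_, fun A hA => MeasurableSpace.measurableSet_generateFrom
    ⟨{⟨A, hA⟩}, {1}, fun x y hxy => ?_⟩⟩
  · have : @Measurable _ _ (MeasurableSpace.generateFrom (finitelyDetermined T α))
        (MeasurableSpace.generateFrom (finitelyDetermined T α)) (T h) := by
      refine @measurable_generateFrom _ _ (MeasurableSpace.generateFrom _) _ _ ?_
      rintro D ⟨s, F, hD⟩
      refine MeasurableSpace.measurableSet_generateFrom ⟨s, F.image (· * h), fun x y hxy => ?_⟩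
      refine hD _ _ fun g hg A hA => ?_
      rw [hT, hT]
      exact hxy _ (Finset.mem_image_of_mem _ hg) A hA
    exact this hA
  · simpa [hT1] using hxy

open Classical in
/-- The element of the finite subfamily `s` of `α` that contains `x`, if there is one. -/
noncomputable def label {α : Set (Set X)} (s : Finset α) (x : X) : Option s :=
  if h : ∃ A : s, x ∈ ((A : α) : Set X) then some h.choose else none

theorem label_eq_some_iff [MeasurableSpace X] {α : Set (Set X)} (hα : IsCountablePartition α)
    (s : Finset α) (x : X) (A : s) : label s x = some A ↔ x ∈ ((A : α) : Set X) := by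
  have huniq : ∀ B : s, x ∈ ((A : α) : Set X) → x ∈ ((B : α) : Set X) → B = A := by
    intro B hA hB
    by_contra hne
    exact Set.disjoint_left.1 (hα.pairwiseDisjoint _ (B : α).2 _ (A : α).2
      fun h => hne (Subtype.ext (Subtype.ext h))) hB hA
  unfold label
  split_ifs with h
  · rw [Option.some_inj]
    exact ⟨fun hA => hA ▸ h.choose_spec, fun hA => huniq _ hA h.choose_spec⟩
  · exact ⟨fun h' => by simp at h', fun hA => absurd ⟨A, hA⟩ h⟩

theorem measurable_label [MeasurableSpace X] {α : Set (Set X)} (hα : IsCountablePartition α)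
    (s : Finset α) : Measurable[_, ⊤] (label s) := by
  have hsome : ∀ A : s, MeasurableSet (label s ⁻¹' {some A}) := by
    intro A
    have : label s ⁻¹' {some A} = ((A : α) : Set X) := by
      ext x; exact label_eq_some_iff hα s x A
    rw [this]
    exact hα.measurableSet _ (A : α).2
  let _ : MeasurableSpace (Option s) := ⊤
  refine measurable_to_countable' fun l => ?_
  cases l with
  | some A => exact hsome A
  | none =>
    have : label s ⁻¹' {none} = (⋃ A : s, label s ⁻¹' {some A})ᶜ := by
      ext x
      cases h : label s x <;> simp [h]
    rw [this]
    exact (MeasurableSet.iUnion hsome).compl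

/-- The labels `some A` contribute a partial sum of the entropy. The merged remainder `none`
contributes at most `1`, since `-m log m ≤ 1 - m`. -/
theorem sum_negMulLog_label_le [MeasurableSpace X] {μ : Measure X} [IsProbabilityMeasure μ]
    {α : Set (Set X)} (hα : IsCountablePartition α) (hH : entropy μ α < ⊤) (s : Finset α) :
    ∑ l, Real.negMulLog (μ.real (label s ⁻¹' {l})) ≤ 1 + (entropy μ α).toReal := by
  rw [Fintype.sum_option]
  refine add_le_add ?_ ?_
  · rcases (measureReal_nonneg : 0 ≤ μ.real (label s ⁻¹' {none})).eq_or_lt with h | h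
    · simp [← h]
    · have := Real.one_sub_inv_le_log_of_pos h
      have h2 := mul_le_mul_of_nonneg_left this h.le
      rw [mul_sub, mul_inv_cancel₀ h.ne'] at h2
      rw [Real.negMulLog, neg_mul]
      linarith
  · have h1 : ∀ A : s, label s ⁻¹' {some A} = ((A : α) : Set X) := by
      intro A; ext x; exact label_eq_some_iff hα s x A
    simp_rw [h1]
    have h2 : ∀ A : α, 0 ≤ Real.negMulLog (μ.real (A : Set X)) := fun A =>
      Real.negMulLog_nonneg measureReal_nonneg measureReal_le_one
    rw [Finset.sum_coe_sort s fun A : α => Real.negMulLog (μ.real (A : Set X)),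
      ← ENNReal.ofReal_le_iff_le_toReal hH.ne, ENNReal.ofReal_sum_of_nonneg fun A _ => h2 A]
    refine le_trans (le_of_eq (Finset.sum_congr rfl fun A _ => ?_)) (ENNReal.sum_le_tsum s)
    rw [Real.negMulLog, neg_mul]

end

/-! ### Transfer from `G` to a finite group. -/

/-- Right cancellation is inherited from the finite groups; it is what makes the shift of a monoid
measure preserving. -/
theorem FinitelySeparated.mul_left_injective {G : Type*} [Monoid G] (hG : FinitelySeparated G)
    (g : G) : Function.Injective fun f : G => f * g := by
  classical
  intro f f' h
  obtain ⟨Q, _, _, φ, hφ⟩ := hG {f, f'}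
  refine hφ (by simp) (by simp) (mul_right_cancel (b := φ g) ?_)
  rw [← map_mul, ← map_mul]
  exact congrArg φ h

section
variable {G K : Type*} [Monoid G] [MeasurableSpace K]

theorem measurable_shift (g : G) : Measurable (shift G K g) := by
  unfold shift; fun_prop

variable (κ : Measure K) [IsProbabilityMeasure κ]

theorem measurePreserving_shift (hG : FinitelySeparated G) (g : G) :
    MeasurePreserving (shift G K g) (Measure.infinitePi fun _ : G => κ)
      (Measure.infinitePi fun _ : G => κ) :=
  ⟨measurable_shift g, map_comp_infinitePi κ (hG.mul_left_injective g)⟩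

/-- For a generating partition, finitely many labels along finitely many group elements allow to
guess the discretised value at the identity. -/
theorem exists_guess_of_isGenerating {α : Set (Set (G → K))} (hα : IsCountablePartition α)
    (hgen : IsGenerating (shift G K) (Measure.infinitePi fun _ : G => κ) α)
    {B : Type*} [Fintype B] [Nonempty B] [MeasurableSpace B] [MeasurableSingletonClass B]
    {b : K → B} (hb : Measurable b) {η : ℝ} (hη : 0 < η) :
    ∃ (s : Finset α) (F : Finset G) (ψ : (F → Option s) → B),
      (Measure.infinitePi fun _ : G => κ).real
        {x | b (x 1) ≠ ψ fun g => label s (shift G K g x)} < η := by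
  classical
  have hle := invariantSigmaAlgebra_le (T := shift G K)
    (fun g h x => funext fun f => by simp [shift, mul_assoc])
    (fun x => funext fun f => by simp [shift]) α
  obtain ⟨c, hc, hcη⟩ := exists_approx_of_isSetAlgebra (Measure.infinitePi fun _ : G => κ)
    (isSetAlgebra_finitelyDetermined (shift G K) α)
    (fun A hA => measurableSet_of_mem_finitelyDetermined measurable_shift hα.measurableSet hA)
    (fun x => b (x 1))
    (fun i => by
      obtain ⟨D, hD, hD0⟩ := hgen ((fun x : G → K => b (x 1)) ⁻¹' {i})
        ((hb.comp (measurable_pi_apply 1)) (measurableSet_singleton i))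
      exact ⟨D, hle D hD, hD0⟩) hη
  choose s F hsF using hc
  let s' := Finset.univ.biUnion s
  let F' := Finset.univ.biUnion F
  have hfac : Function.FactorsThrough c fun x (g : F') => label s' (shift G K g x) := by
    intro x y hxy
    refine (((hsF (c x) x y) fun g hg A hA => ?_).1 rfl).symm
    have hg' : g ∈ F' := Finset.mem_biUnion.2 ⟨_, Finset.mem_univ _, hg⟩
    have hA' : A ∈ s' := Finset.mem_biUnion.2 ⟨_, Finset.mem_univ _, hA⟩
    rw [← label_eq_some_iff hα s' _ ⟨A, hA'⟩, ← label_eq_some_iff hα s' _ ⟨A, hA'⟩]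
    have := congrFun hxy ⟨g, hg'⟩
    simp only at this
    rw [this]
  obtain ⟨ψ, hψ⟩ := (Function.factorsThrough_iff _).1 hfac
  refine ⟨s', F', ψ, ?_⟩
  rw [hψ] at hcη
  exact hcη

/-- A finite-entropy generating partition bounds the number of atoms of equidistributed
partitions of the base. -/
theorem log_le_of_isGenerating (hG : FinitelySeparated G) {α : Set (Set (G → K))}
    (hα : IsCountablePartition α) (hH : entropy (Measure.infinitePi fun _ : G => κ) α < ⊤)
    (hgen : IsGenerating (shift G K) (Measure.infinitePi fun _ : G => κ) α)
    {k : ℕ} (hk : 0 < k) {b : K → Fin (k + 1)} (hb : Measurable b)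
    (hbk : ∀ i, κ.real (b ⁻¹' {i}) ≤ 1 / k) :
    Real.log k ≤ (Real.log 2 + (1 + (entropy (Measure.infinitePi fun _ : G => κ) α).toReal) + 1) +
      Real.log 2 + 1 := by
  classical
  set μ : Measure (G → K) := Measure.infinitePi fun _ : G => κ
  have hk0 : (0 : ℝ) < k + 1 := by positivity
  -- Chosen so that an error probability `2 * η` costs at most `log (k + 1) * 2 * η ≤ 1`.
  let η : ℝ := 1 / (2 * (k + 1))
  have hη : 0 < η := by positivity
  obtain ⟨s, F, ψ, hψ⟩ := exists_guess_of_isGenerating κ hα hgen hb hη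
  let _ : MeasurableSpace (Option s) := ⊤
  have hℓ : Measurable (label s) := measurable_label hα s
  obtain ⟨p, hp, hp1, hpH⟩ := exists_weight (μ := μ) hℓ
  have hp0 : ∀ l, 0 ≤ -Real.log (p l) := fun l => neg_nonneg.2 <| Real.log_nonpos (hp l).le <|
    (Finset.single_le_sum (fun l _ => (hp l).le) (Finset.mem_univ l)).trans hp1
  let M : ℝ := ∑ l, -Real.log (p l)
  have hM : 0 ≤ M := Finset.sum_nonneg fun l _ => hp0 l
  -- Small enough for two purposes: `δ * M ≤ 1` limits the change in cross-entropy, and `F.card * δ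
  -- ≤ η` the added guessing error.
  let δ : ℝ := η / (M + F.card + 1)
  have hden : 0 < M + F.card + 1 := by positivity
  have hδ : 0 < δ := by positivity
  have hη1 : η ≤ 1 := by
    rw [div_le_one (by positivity)]
    linarith [k.cast_nonneg (α := ℝ)]
  have hδM : δ * M ≤ 1 := by
    rw [div_mul_eq_mul_div, div_le_one hden]
    nlinarith [(Nat.cast_nonneg F.card : (0 : ℝ) ≤ F.card)]
  have hδF : F.card * δ ≤ η := by
    rw [mul_div_assoc', div_le_iff₀ hden]
    nlinarith [(Nat.cast_nonneg F.card : (0 : ℝ) ≤ F.card)]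
  obtain ⟨ℓ', W, hℓ', hW, hδ'⟩ := exists_approx_dependsOn μ hℓ hδ
  have herr : μ.real {x | b (x 1) ≠ ψ fun g => ℓ' (shift G K g x)} ≤ 2 * η := by
    have hsub : {x | b (x 1) ≠ ψ fun g => ℓ' (shift G K g x)} ⊆
        {x | b (x 1) ≠ ψ fun g => label s (shift G K g x)} ∪
          ⋃ g ∈ F, shift G K g ⁻¹' {x | label s x ≠ ℓ' x} := by
      intro x hx
      by_contra hn
      simp only [Set.mem_union, Set.mem_ofPred_eq, Set.mem_iUnion, Set.mem_preimage, not_or,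
        not_exists, not_not] at hn hx
      refine hx (hn.1.trans (congrArg ψ (funext fun g => hn.2 g g.2)))
    have hms : MeasurableSet {x | label s x ≠ ℓ' x} := (measurableSet_eq_fun hℓ hℓ').compl
    calc _ ≤ μ.real {x | b (x 1) ≠ ψ fun g => label s (shift G K g x)} +
          μ.real (⋃ g ∈ F, shift G K g ⁻¹' {x | label s x ≠ ℓ' x}) :=
          (measureReal_mono hsub).trans (measureReal_union_le _ _)
      _ ≤ η + ∑ g ∈ F, μ.real (shift G K g ⁻¹' {x | label s x ≠ ℓ' x}) :=
          add_le_add hψ.le (measureReal_biUnion_finset_le _ _)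
      _ ≤ η + ∑ _g ∈ F, δ := by
          refine add_le_add le_rfl (Finset.sum_le_sum fun g _ => ?_)
          rw [(measurePreserving_shift κ hG g).measureReal_preimage hms.nullMeasurableSet]
          exact hδ'.le
      _ ≤ 2 * η := by
          rw [Finset.sum_const, nsmul_eq_mul]
          linarith
  -- The window holds every coordinate used by the value at `1`, by `ℓ'` at the identity, and by
  -- `ℓ'` at the elements of `F`.
  obtain ⟨Q, _, _, φ, hφ⟩ := hG (insert 1 (W ∪ Finset.image₂ (· * ·) W F))
  have hinj : ∀ v : Q, Set.InjOn (fun g : G => φ g * v)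
      ↑(insert 1 (W ∪ Finset.image₂ (· * ·) W F)) :=
    fun v f hf g hg h => hφ hf hg (mul_right_cancel h)
  -- `Φ v y` reads `y` along the orbit of `v`. Its law need not be `μ`, but it agrees with `μ` on
  -- events in the window, and by `hshift` the shift by `g` becomes the move from `v` to `φ g * v`.
  let Φ : Q → (Q → K) → G → K := fun v y g => y (φ g * v)
  have hΦ : ∀ v, Measurable (Φ v) := fun v => by fun_prop
  have hshift : ∀ g v y, shift G K g (Φ v y) = Φ (φ g * v) y := by
    intro g v y
    funext f
    simp [shift, Φ, mul_assoc]
  let ν : Measure (Q → K) := Measure.pi fun _ : Q => κ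
  have htransfer : ∀ (v : Q) (A : Set (G → K)), MeasurableSet A →
      DependsOn (· ∈ A) (↑(insert 1 (W ∪ Finset.image₂ (· * ·) W F)) : Set G) →
      ν.real (Φ v ⁻¹' A) = μ.real A := by
    intro v A hA hd
    have := infinitePi_preimage_of_injOn κ (hinj v) hA hd
    rw [Measure.infinitePi_eq_pi] at this
    exact congrArg ENNReal.toReal this
  refine log_le_of_guess κ (V := Q) (L := Option s) hk hb hbk (a := fun v y => ℓ' (Φ v y))
    (fun v => hℓ'.comp (hΦ v)) hp hp1 (fun v u => ψ fun g => u (φ g * v)) (fun v => ?_)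
    (fun v => ?_)
  · have h1 : ∫ y, -Real.log (p (ℓ' (Φ v y))) ∂ν = ∫ x, -Real.log (p (ℓ' x)) ∂μ := by
      rw [integral_comp_of_finite (ℓ := fun y => ℓ' (Φ v y)) (hℓ'.comp (hΦ v)) fun l => -Real.log (p l),
        integral_comp_of_finite hℓ' fun l => -Real.log (p l)]
      refine Finset.sum_congr rfl fun l _ => congrArg (· * _) ?_
      refine htransfer v _ (hℓ' (measurableSet_singleton l)) fun x y hxy => ?_
      simp only [Set.mem_preimage]
      rw [hW fun i hi => hxy i (Finset.mem_coe.2 (Finset.mem_insert_of_mem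
        (Finset.mem_union_left _ hi)))]
    change ∫ y, -Real.log (p (ℓ' (Φ v y))) ∂ν ≤ _
    rw [h1]
    have h2 := integral_comp_le_of_approx (μ := μ) hℓ hℓ' hp0
    have h3 := sum_negMulLog_label_le (μ := μ) hα hH s
    have h4 : μ.real {x | label s x ≠ ℓ' x} * M ≤ 1 :=
      (mul_le_mul_of_nonneg_right hδ'.le hM).trans hδM
    simp only [M] at h4
    linarith
  · have hm1 : Measurable fun x : G → K => b (x 1) := hb.comp (measurable_pi_apply 1)
    have hm2 : Measurable fun x : G → K => ψ fun g => ℓ' (shift G K g x) :=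
      (measurable_of_finite ψ).comp
        (measurable_pi_lambda _ fun g => hℓ'.comp (measurable_shift _))
    have h1 : ν.real {y | b (y v) ≠ ψ fun g => ℓ' (Φ (φ g * v) y)} =
        μ.real {x | b (x 1) ≠ ψ fun g => ℓ' (shift G K g x)} := by
      rw [← htransfer v {x | b (x 1) ≠ ψ fun g => ℓ' (shift G K g x)}
        (measurableSet_eq_fun hm1 hm2).compl]
      · congr 1
        ext y
        simp only [Set.mem_ofPred_eq, Set.mem_preimage, hshift]
        simp [Φ]
      · intro x y hxy
        have hx1 : x 1 = y 1 := hxy 1 (Finset.mem_coe.2 (Finset.mem_insert_self _ _))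
        have hx2 : ∀ g : F, ℓ' (shift G K g x) = ℓ' (shift G K g y) := fun g =>
          hW fun f hf => hxy _ (Finset.mem_coe.2 (Finset.mem_insert_of_mem
            (Finset.mem_union_right _ (Finset.mem_image₂_of_mem hf g.2))))
        simp only [Set.mem_ofPred_eq, hx1, hx2]
    change Real.log (k + 1) * ν.real {y | b (y v) ≠ ψ fun g => ℓ' (Φ (φ g * v) y)} ≤ 1
    rw [h1]
    calc _ ≤ (k + 1 : ℝ) * (2 * η) := by
          have := Real.log_le_sub_one_of_pos hk0
          exact mul_le_mul (by linarith) herr measureReal_nonneg hk0.le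
      _ = 1 := by
          simp only [η]; field_simp

end

/-! ### The unit interval and the conclusion. -/

theorem exists_equidistributed_unitInterval (k : ℕ) (hk : 0 < k) :
    ∃ b : unitInterval → Fin (k + 1), Measurable b ∧
      ∀ i, (volume : Measure unitInterval).real (b ⁻¹' {i}) ≤ 1 / k := by
  have hk' : (0 : ℝ) < k := by exact_mod_cast hk
  have hlt : ∀ t : unitInterval, ⌊(k : ℝ) * t⌋₊ < k + 1 := by
    intro t
    rw [Nat.floor_lt (mul_nonneg hk'.le t.2.1)]
    -- The extra value `k` is taken only at `t = 1`, which is why there are `k + 1` values rather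
    -- than `k`.
    push_cast
    have := mul_le_mul_of_nonneg_left t.2.2 hk'.le
    linarith
  have hm : Measurable fun t : unitInterval => ⌊(k : ℝ) * t⌋₊ :=
    Nat.measurable_floor.comp (measurable_subtype_coe.const_mul _)
  have hfib : ∀ i : Fin (k + 1), (fun t => (⟨_, hlt t⟩ : Fin (k + 1))) ⁻¹' {i} =
      (fun t : unitInterval => ⌊(k : ℝ) * t⌋₊) ⁻¹' {(i : ℕ)} := by
    intro i; ext t; simp [Fin.ext_iff]
  refine ⟨fun t => ⟨_, hlt t⟩, measurable_to_countable' fun i => ?_, fun i => ?_⟩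
  · rw [hfib]
    exact hm (measurableSet_singleton _)
  · rw [hfib, Measure.real, unitInterval.volume_apply]
    refine ENNReal.toReal_le_of_le_ofReal (by positivity) ?_
    have hsub : Subtype.val '' ((fun t : unitInterval => ⌊(k : ℝ) * t⌋₊) ⁻¹' {(i : ℕ)}) ⊆
        Set.Icc ((i : ℝ) / k) (((i : ℝ) + 1) / k) := by
      rintro _ ⟨t, ht, rfl⟩
      rw [Set.mem_preimage, Set.mem_singleton_iff,
        Nat.floor_eq_iff (mul_nonneg hk'.le t.2.1)] at ht
      constructor
      · rw [div_le_iff₀ hk']; linarith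
      · rw [le_div_iff₀ hk']; linarith
    refine (measure_mono hsub).trans (le_of_eq ?_)
    rw [Real.volume_Icc]
    congr 1
    ring

theorem not_exists_isGenerating {G : Type*} [Monoid G] (hG : FinitelySeparated G) :
    ¬ ∃ α : Set (Set (G → unitInterval)), IsCountablePartition α ∧
      entropy (lebesguePower G) α < ⊤ ∧
      IsGenerating (shift G unitInterval) (lebesguePower G) α := by
  rintro ⟨α, hα, hH, hgen⟩
  have hbound : ∀ k : ℕ, 0 < k → Real.log k ≤ _ := fun k hk => by
    obtain ⟨b, hb, hbk⟩ := exists_equidistributed_unitInterval k hk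
    exact log_le_of_isGenerating volume hG hα hH hgen hk hb hbk
  have hlim := (Real.tendsto_log_atTop.comp tendsto_natCast_atTop_atTop).eventually_gt_atTop
    ((Real.log 2 + (1 + (entropy (lebesguePower G) α).toReal) + 1) + Real.log 2 + 1)
  obtain ⟨k, hk1, hk2⟩ := (hlim.and (Filter.eventually_gt_atTop 0)).exists
  exact (hbound k hk2).not_gt hk1

end FreeShift

theorem mainTheorem11 (r : ℕ) :
    (¬ ∃ α : Set (Set (FreeGroup (Fin r) → unitInterval)),
        FreeShift.IsCountablePartition α ∧
        FreeShift.entropy (FreeShift.lebesguePower (FreeGroup (Fin r))) α < ⊤ ∧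
        FreeShift.IsGenerating (FreeShift.shift (FreeGroup (Fin r)) unitInterval)
          (FreeShift.lebesguePower (FreeGroup (Fin r))) α) ∧
    (¬ ∃ α : Set (Set (FreeMonoid (Fin r) → unitInterval)),
        FreeShift.IsCountablePartition α ∧
        FreeShift.entropy (FreeShift.lebesguePower (FreeMonoid (Fin r))) α < ⊤ ∧
        FreeShift.IsGenerating (FreeShift.shift (FreeMonoid (Fin r)) unitInterval)
          (FreeShift.lebesguePower (FreeMonoid (Fin r))) α) :=
  ⟨FreeShift.not_exists_isGenerating (FreeShift.finitelySeparated_freeGroup r),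
    FreeShift.not_exists_isGenerating (FreeShift.finitelySeparated_freeMonoid r)⟩
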